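/- Let $F$ be the oriented graph (an orientation of $C_4$) on four distinct vertices $x,y_1,y_2,z$ with arcs $x\to y_1$, $x\to y_2$, $y_1\to z$, $y_2\to z$. An oriented graph is a digraph without loops in which any two vertices are joined by at most one arc, and $\mathrm{ex}_o(n,F)$ denotes the largest number of arcs in an oriented graph on $n$ vertices that does not contain $F$ as a (not necessarily induced) subgraph. Then for all sufficiently large $n$, $$\mathrm{ex}_o(n,F)=\left\lfloor \frac{n^2}{4}\right\rfloor+\left\lceil \frac n2\right\rceil .$$ Moreover, for all sufficiently large $n$, this value is attained by the following construction: take a complete bipartite graph with parts of sizes $\lceil n/2\rceil$ and $\lfloor n/2\rfloor$, orient all its edges from one part to the other (in either direction), and add a directed cycle of length $\lceil n/2\rceil$ through all vertices of the part of size $\lceil n/2\rceil$. Every oriented graph obtained in this way is $F$-free and has exactly $\lfloor n^2/4\rfloor+\lceil n/2\rceil$ arcs. -/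

import Mathlib

namespace OrientedTuran

/-- A digraph is an oriented graph if it has at most one arc between any two vertices and no
loops. (Taking `u = v` in the condition excludes loops.) -/
def IsOriented {V : Type*} (G : Digraph V) : Prop :=
  ∀ u v, G.Adj u v → ¬ G.Adj v u

/-- `G` contains `F` as a (not necessarily induced) subgraph. -/
def Contains {V W : Type*} (G : Digraph V) (F : Digraph W) : Prop :=
  ∃ φ : W → V, Function.Injective φ ∧ ∀ a b, F.Adj a b → G.Adj (φ a) (φ b)

/-- `G` is `F`-free. -/
def Free {V W : Type*} (G : Digraph V) (F : Digraph W) : Prop :=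
  ¬ Contains G F

/-- The number of arcs of a finite digraph. -/
noncomputable def arcCount {V : Type*} [Fintype V] (G : Digraph V) : ℕ :=
  {p : V × V | G.Adj p.1 p.2}.ncard

open Classical in
/-- The oriented Turán number: the largest number of arcs of an `F`-free oriented graph on
`n` vertices. -/
noncomputable def exo {W : Type*} (n : ℕ) (F : Digraph W) : ℕ :=
  (Finset.univ.filter fun G : Digraph (Fin n) => IsOriented G ∧ Free G F).sup arcCount

/-- The orientation of the four-cycle with arcs `x → y₁`, `x → y₂`, `y₁ → z`, `y₂ → z`, where
`x = 0`, `y₁ = 1`, `y₂ = 2`, `z = 3`. -/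
def orientedC4 : Digraph (Fin 4) where
  Adj a b := (a = 0 ∧ b = 1) ∨ (a = 0 ∧ b = 2) ∨ (a = 1 ∧ b = 3) ∨ (a = 2 ∧ b = 3)

/-- `G` is an antidirected complete bipartite graph with parts of sizes `⌈n/2⌉` and `⌊n/2⌋`
(all arcs between the parts go in the same direction, either one), together with a directed cycle
through all the vertices of the part `A` of size `⌈n/2⌉`. The directed cycle is `v → σ v`, `v ∈ A`,
for a cyclic permutation `σ` of `A`. -/
def IsBipartiteWithCycle {n : ℕ} (G : Digraph (Fin n)) : Prop :=
  ∃ (A : Finset (Fin n)) (σ : Equiv.Perm (Fin n)),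
    A.card = (n + 1) / 2 ∧ σ.IsCycle ∧ σ.support = A ∧
    ((∀ u v, G.Adj u v ↔ (u ∈ A ∧ v ∉ A) ∨ (u ∈ A ∧ v = σ u)) ∨
     (∀ u v, G.Adj u v ↔ (u ∉ A ∧ v ∈ A) ∨ (u ∈ A ∧ v = σ u)))

end OrientedTuran

/-!
An oriented graph is `F`-free exactly when any two vertices are joined by at most one path of length
two. Deleting vertices of small degree, we may assume that all degrees are at least about half the
number `n` of vertices. There are at most `n ^ 2` paths of length two in total, so the smaller of
the two degrees at a vertex is bounded on average, and a maximum directed cut `S → T` contains all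
but `O(n)` arcs. Counting the paths of length two from `S` to `T` more carefully shows that each
vertex of `S` sends arcs to all but `n / 10` vertices of `T`, and dually. Two out-neighbours of one
vertex cannot have a common out-neighbour, so every vertex has at most one out-neighbour in `S` and,
dually, at most one in-neighbour in `T`.

It remains to bound the number of arcs inside `S` and `T` by `max #S #T` plus the number of pairs
missing between `S` and `T`. Suppose this fails, with at least as many arcs inside `S` as inside
`T`. Then some `v` in `T` has an in-neighbour in `T` and is joined to all of `S`, which forces most
arcs inside `S` to point to a single hub `x`. The out-neighbours of `x` have no in-neighbours in
`T`, so the arcs inside `T` are paid for by the pairs missing at `x`.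
-/

namespace OrientedTuran

open Finset

section Counting

variable {V : Type*} {r : V → V → Prop}

open Classical in
/-- The number of out-neighbours of `v` in `A`. -/
noncomputable def outDeg (r : V → V → Prop) (A : Finset V) (v : V) : ℕ := #{w ∈ A | r v w}

open Classical in
/-- The number of in-neighbours of `v` in `A`. -/
noncomputable def inDeg (r : V → V → Prop) (A : Finset V) (v : V) : ℕ := #{w ∈ A | r w v}

open Classical in
/-- The vertices of `A` joined to `v` in neither direction (`v` itself may be among them). -/
noncomputable def nonNbrs (r : V → V → Prop) (A : Finset V) (v : V) : Finset V :=
  {w ∈ A | ¬ r v w ∧ ¬ r w v}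

/-- The number of arcs from `A` to `B`. -/
noncomputable def arcs (r : V → V → Prop) (A B : Finset V) : ℕ := ∑ v ∈ A, outDeg r B v

/-- The number of pairs in `A × B` joined in neither direction. -/
noncomputable def nonArcs (r : V → V → Prop) (A B : Finset V) : ℕ := ∑ v ∈ A, #(nonNbrs r B v)

lemma mem_nonNbrs {A : Finset V} {v w : V} : w ∈ nonNbrs r A v ↔ w ∈ A ∧ ¬ r v w ∧ ¬ r w v := by
  simp only [nonNbrs, mem_filter]

lemma adj_or_adj_of_nonNbrs_eq_empty {A : Finset V} {v w : V} (h : nonNbrs r A v = ∅)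
    (hw : w ∈ A) : r v w ∨ r w v := by
  by_contra! hadj
  exact notMem_empty w (h ▸ mem_nonNbrs.2 ⟨hw, hadj⟩)

lemma inDeg_flip (A : Finset V) (v : V) : inDeg (flip r) A v = outDeg r A v := rfl

lemma outDeg_flip (A : Finset V) (v : V) : outDeg (flip r) A v = inDeg r A v := rfl

lemma nonNbrs_flip (A : Finset V) (v : V) : nonNbrs (flip r) A v = nonNbrs r A v := by
  ext w
  simp only [mem_nonNbrs, flip, and_comm]

lemma arcs_eq_sum_inDeg (r : V → V → Prop) (A B : Finset V) :
    arcs r A B = ∑ w ∈ B, inDeg r A w := by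
  classical
  exact sum_card_bipartiteAbove_eq_sum_card_bipartiteBelow r

lemma arcs_flip (A B : Finset V) : arcs (flip r) B A = arcs r A B :=
  (arcs_eq_sum_inDeg r A B).symm

lemma sum_nonNbrs_comm (r : V → V → Prop) (A B : Finset V) (f : V → V → ℕ) :
    ∑ a ∈ A, ∑ b ∈ nonNbrs r B a, f a b = ∑ b ∈ B, ∑ a ∈ nonNbrs r A b, f a b :=
  sum_comm' fun a b => by simp only [mem_nonNbrs]; tauto

lemma nonArcs_comm (r : V → V → Prop) (A B : Finset V) : nonArcs r A B = nonArcs r B A := by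
  simpa only [nonArcs, card_eq_sum_ones] using sum_nonNbrs_comm r A B fun _ _ => 1

lemma outDeg_pos {A : Finset V} {v : V} : 0 < outDeg r A v ↔ ∃ w ∈ A, r v w := by
  simp only [outDeg, card_pos, Finset.Nonempty, mem_filter]

lemma inDeg_pos {A : Finset V} {v : V} : 0 < inDeg r A v ↔ ∃ w ∈ A, r w v :=
  outDeg_pos (r := flip r)

lemma eq_of_outDeg_le_one {A : Finset V} {v x y : V} (h : outDeg r A v ≤ 1) (hx : x ∈ A)
    (hy : y ∈ A) (hvx : r v x) (hvy : r v y) : x = y := by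
  classical
  exact card_le_one.1 h x (mem_filter.2 ⟨hx, hvx⟩) y (mem_filter.2 ⟨hy, hvy⟩)

lemma eq_of_inDeg_le_one {A : Finset V} {v x y : V} (h : inDeg r A v ≤ 1) (hx : x ∈ A)
    (hy : y ∈ A) (hxv : r x v) (hyv : r y v) : x = y :=
  eq_of_outDeg_le_one (r := flip r) h hx hy hxv hyv

lemma outDeg_add_outDeg_le_card {A : Finset V} {y y' : V} (hA : ∀ z ∈ A, r y z → ¬ r y' z) :
    outDeg r A y + outDeg r A y' ≤ #A := by
  classical
  rw [outDeg, outDeg, ← card_union_of_disjoint (disjoint_filter.2 hA)]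
  exact card_le_card (union_subset (filter_subset _ _) (filter_subset _ _))

lemma exists_common_inNbr {A : Finset V} {y y' : V} (h : #A < inDeg r A y + inDeg r A y') :
    ∃ u ∈ A, r u y ∧ r u y' := by
  by_contra! hA
  exact h.not_ge (outDeg_add_outDeg_le_card (r := flip r) hA)

lemma inDeg_mono {A B : Finset V} (h : A ⊆ B) (v : V) : inDeg r A v ≤ inDeg r B v := by
  classical
  exact card_le_card (filter_subset_filter _ h)

lemma outDeg_le_card (A : Finset V) (v : V) : outDeg r A v ≤ #A := by
  classical
  exact card_filter_le _ _

lemma arcs_le_card_mul_card (A B : Finset V) : arcs r A B ≤ #A * #B :=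
  sum_le_card_nsmul _ _ _ fun v _ => outDeg_le_card B v

section DecidableEq

variable [DecidableEq V]

lemma outDeg_union {A B : Finset V} (h : Disjoint A B) (v : V) :
    outDeg r (A ∪ B) v = outDeg r A v + outDeg r B v := by
  classical
  rw [outDeg, filter_union, card_union_of_disjoint (disjoint_filter_filter h), outDeg, outDeg]

lemma inDeg_union {A B : Finset V} (h : Disjoint A B) (v : V) :
    inDeg r (A ∪ B) v = inDeg r A v + inDeg r B v :=
  outDeg_union (r := flip r) h v

lemma arcs_union_left {A B : Finset V} (h : Disjoint A B) (C : Finset V) :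
    arcs r (A ∪ B) C = arcs r A C + arcs r B C :=
  sum_union h

lemma arcs_union_right {A B : Finset V} (h : Disjoint A B) (C : Finset V) :
    arcs r C (A ∪ B) = arcs r C A + arcs r C B := by
  simp only [← arcs_flip (r := r) C, arcs_union_left h]

lemma arcs_union_self {A B : Finset V} (h : Disjoint A B) :
    arcs r (A ∪ B) (A ∪ B) = arcs r A B + arcs r A A + arcs r B B + arcs r B A := by
  rw [arcs_union_left h, arcs_union_right h, arcs_union_right h]
  ring

lemma arcs_erase_add_left {A : Finset V} {v : V} (hv : v ∈ A) (B : Finset V) :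
    arcs r (A.erase v) B + outDeg r B v = arcs r A B :=
  sum_erase_add _ _ hv

lemma arcs_erase_add_right {B : Finset V} {v : V} (hv : v ∈ B) (A : Finset V) :
    arcs r A (B.erase v) + inDeg r A v = arcs r A B := by
  simpa only [arcs_flip, outDeg_flip] using arcs_erase_add_left (r := flip r) hv A

lemma outDeg_erase_self {v : V} (hv : ¬ r v v) (A : Finset V) :
    outDeg r (A.erase v) v = outDeg r A v := by
  classical
  rw [outDeg, outDeg, filter_erase, erase_eq_of_notMem fun h => hv (mem_filter.1 h).2]

lemma inDeg_erase_self {v : V} (hv : ¬ r v v) (A : Finset V) :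
    inDeg r (A.erase v) v = inDeg r A v :=
  outDeg_erase_self (r := flip r) hv A

lemma arcs_erase_erase {v : V} (hv : ¬ r v v) {A : Finset V} (hvA : v ∈ A) :
    arcs r (A.erase v) (A.erase v) + outDeg r A v + inDeg r A v = arcs r A A := by
  rw [← arcs_erase_add_right hvA A, ← arcs_erase_add_left hvA (A.erase v), outDeg_erase_self hv]

end DecidableEq

end Counting

section MaxCut

variable {V : Type*} [DecidableEq V] {r : V → V → Prop} {S T : Finset V}

/-- `(S, T)` is a directed cut of `S ∪ T` with the largest possible number of arcs. -/
structure IsMaxCut (r : V → V → Prop) (S T : Finset V) : Prop where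
  disjoint : Disjoint S T
  arcs_le : ∀ S' T', Disjoint S' T' → S' ∪ T' = S ∪ T → arcs r S' T' ≤ arcs r S T

lemma exists_isMaxCut (r : V → V → Prop) (W : Finset V) :
    ∃ S T, IsMaxCut r S T ∧ S ∪ T = W := by
  obtain ⟨S, hS, hmax⟩ := exists_max_image W.powerset (fun S => arcs r S (W \ S))
    ⟨W, mem_powerset_self W⟩
  have hW : S ∪ W \ S = W := union_sdiff_of_subset (mem_powerset.1 hS)
  refine ⟨S, W \ S, ⟨disjoint_sdiff, fun S' T' hd hu => ?_⟩, hW⟩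
  rw [hW] at hu
  have hT' : W \ S' = T' := by rw [← hu, union_sdiff_cancel_left hd]
  rw [← hT']
  exact hmax S' (mem_powerset.2 (hu ▸ subset_union_left))

namespace IsMaxCut

lemma reverse (h : IsMaxCut r S T) : IsMaxCut (flip r) T S where
  disjoint := h.disjoint.symm
  arcs_le S' T' hd hu := by
    rw [arcs_flip, arcs_flip]
    exact h.arcs_le T' S' hd.symm (by rw [union_comm, hu, union_comm])

lemma inDeg_le_outDeg (h : IsMaxCut r S T) {s : V} (hs : s ∈ S) (hirr : ¬ r s s) :
    inDeg r S s ≤ outDeg r T s := by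
  have hsT : s ∉ T := disjoint_left.1 h.disjoint hs
  have hmove := h.arcs_le (S.erase s) (insert s T)
    (disjoint_insert_right.2 ⟨notMem_erase s S, h.disjoint.mono_left (erase_subset s S)⟩)
    (by rw [union_insert, ← insert_union, insert_erase hs])
  rw [← arcs_erase_add_right (mem_insert_self s T), erase_insert hsT, inDeg_erase_self hirr,
    ← arcs_erase_add_left hs] at hmove
  omega

lemma outDeg_le_inDeg (h : IsMaxCut r S T) {t : V} (ht : t ∈ T) (hirr : ¬ r t t) :
    outDeg r T t ≤ inDeg r S t :=
  h.reverse.inDeg_le_outDeg ht hirr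

/-- Compare with the cut that separates the vertices with `inDeg ≤ outDeg` from the rest. -/
lemma arcs_self_le (h : IsMaxCut r S T) :
    arcs r (S ∪ T) (S ∪ T) ≤
      arcs r S T + ∑ v ∈ S ∪ T, min (inDeg r (S ∪ T) v) (outDeg r (S ∪ T) v) := by
  set W := S ∪ T
  set A := {v ∈ W | inDeg r W v ≤ outDeg r W v}
  set B := {v ∈ W | ¬ inDeg r W v ≤ outDeg r W v}
  have hd : Disjoint A B := disjoint_filter_filter_not _ _ _
  have hW : A ∪ B = W := filter_union_filter_not_eq _ _
  have hAA : arcs r A A ≤ ∑ v ∈ A, min (inDeg r W v) (outDeg r W v) := by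
    rw [arcs_eq_sum_inDeg]
    refine sum_le_sum fun v hv => ?_
    rw [min_eq_left (mem_filter.1 hv).2]
    exact inDeg_mono (filter_subset _ _) v
  have hBW : arcs r B W = ∑ v ∈ B, min (inDeg r W v) (outDeg r W v) :=
    sum_congr rfl fun v hv => (min_eq_right (not_le.1 (mem_filter.1 hv).2).le).symm
  calc arcs r W W = arcs r A W + arcs r B W := by rw [← arcs_union_left hd, hW]
    _ = arcs r A B + (arcs r A A + arcs r B W) := by
      rw [← hW, arcs_union_right hd, hW]; ring
    _ ≤ arcs r S T + (∑ v ∈ A, min (inDeg r W v) (outDeg r W v) +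
          ∑ v ∈ B, min (inDeg r W v) (outDeg r W v)) :=
      add_le_add (h.arcs_le A B hd hW) (add_le_add hAA hBW.le)
    _ = _ := by rw [← sum_union hd, hW]

end IsMaxCut

end MaxCut

/-- An asymmetric relation with at most one path of length two between any two vertices. -/
structure UniqueTwoPaths {V : Type*} (r : V → V → Prop) : Prop where
  asymm : ∀ u v, r u v → ¬ r v u
  unique : ∀ x y y' z, r x y → r x y' → r y z → r y' z → y = y'

namespace UniqueTwoPaths

variable {V : Type*} {r : V → V → Prop}

lemma reverse (h : UniqueTwoPaths r) : UniqueTwoPaths (flip r) where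
  asymm u v huv hvu := h.asymm v u huv hvu
  unique x y y' z hyx hyx' hzy hzy' := h.unique z y y' x hzy hzy' hyx hyx'

lemma irrefl (h : UniqueTwoPaths r) (v : V) : ¬ r v v := fun hv => h.asymm v v hv hv

lemma card_eq (h : UniqueTwoPaths r) (A : Finset V) (v : V) :
    #A = outDeg r A v + inDeg r A v + #(nonNbrs r A v) := by
  classical
  simp only [outDeg, inDeg, nonNbrs, card_filter, ← sum_add_distrib]
  rw [card_eq_sum_ones]
  refine sum_congr rfl fun w _ => ?_
  have := h.asymm v w
  by_cases hvw : r v w <;> by_cases hwv : r w v <;> simp_all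

lemma card_mul_card_eq (h : UniqueTwoPaths r) (A B : Finset V) :
    #A * #B = arcs r A B + arcs r B A + nonArcs r A B := by
  rw [arcs_eq_sum_inDeg r B A, arcs, nonArcs, ← sum_add_distrib, ← sum_add_distrib,
    ← smul_eq_mul, ← sum_const]
  exact sum_congr rfl fun v _ => h.card_eq B v

/-- The left side counts the paths of length two from `A` to `B` with middle vertex in `Y`. -/
lemma sum_inDeg_mul_outDeg_le (h : UniqueTwoPaths r) (A B Y : Finset V) :
    ∑ y ∈ Y, inDeg r A y * outDeg r B y ≤ #A * #B := by
  classical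
  simp only [inDeg, outDeg, ← card_product]
  rw [← card_biUnion]
  · exact card_le_card (biUnion_subset.2 fun y _ =>
      product_subset_product (filter_subset _ _) (filter_subset _ _))
  · intro y _ y' _ hne
    refine disjoint_left.2 fun p hp hp' => hne ?_
    simp only [mem_product, mem_filter] at hp hp'
    exact h.unique p.1 y y' p.2 hp.1.2 hp'.1.2 hp.2.2 hp'.2.2

lemma sum_inDeg_le (h : UniqueTwoPaths r) (A : Finset V) {Y : Finset V} {w : V}
    (hY : ∀ y ∈ Y, r y w) : ∑ y ∈ Y, inDeg r A y ≤ #A := by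
  classical
  calc ∑ y ∈ Y, inDeg r A y = ∑ y ∈ Y, inDeg r A y * outDeg r {w} y := by
        refine sum_congr rfl fun y hy => ?_
        rw [outDeg, filter_true_of_mem (by simpa using hY y hy), card_singleton, mul_one]
    _ ≤ #A * #{w} := h.sum_inDeg_mul_outDeg_le A {w} Y
    _ = #A := by rw [card_singleton, mul_one]

lemma outDeg_add_outDeg_le (h : UniqueTwoPaths r) {x y y' : V} (hne : y ≠ y') (hy : r x y)
    (hy' : r x y') (A : Finset V) : outDeg r A y + outDeg r A y' ≤ #A :=
  outDeg_add_outDeg_le_card fun z _ hyz hyz' => hne (h.unique x y y' z hy hy' hyz hyz')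

/-- One of the two degrees at each vertex is at least `#W / 5`, so the smaller one is at most
`5 / #W` times the number of paths of length two through the vertex. -/
lemma sum_min_degree_le (h : UniqueTwoPaths r) {W : Finset V} (hW : 5 ≤ #W)
    (hdeg : ∀ v ∈ W, #W ≤ 2 * (outDeg r W v + inDeg r W v) + 1) :
    ∑ v ∈ W, min (inDeg r W v) (outDeg r W v) ≤ 5 * #W := by
  refine Nat.le_of_mul_le_mul_right (c := #W) ?_ (by omega)
  calc (∑ v ∈ W, min (inDeg r W v) (outDeg r W v)) * #W
      ≤ ∑ v ∈ W, 5 * (inDeg r W v * outDeg r W v) := by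
        rw [sum_mul]
        refine sum_le_sum fun v hv => ?_
        have hmax : #W ≤ 5 * max (inDeg r W v) (outDeg r W v) := by
          have := hdeg v hv
          omega
        calc min (inDeg r W v) (outDeg r W v) * #W
            ≤ min (inDeg r W v) (outDeg r W v) * (5 * max (inDeg r W v) (outDeg r W v)) :=
              Nat.mul_le_mul_left _ hmax
          _ = 5 * (inDeg r W v * outDeg r W v) := by rw [mul_left_comm, min_mul_max]
    _ ≤ 5 * (#W * #W) := by
        rw [← mul_sum]
        exact Nat.mul_le_mul_left 5 (h.sum_inDeg_mul_outDeg_le W W W)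
    _ = 5 * #W * #W := (mul_assoc _ _ _).symm

end UniqueTwoPaths

/-- A cut `S → T` of a large graph without two paths of length two between the same ends, which is
optimal under moving a single vertex, has few arcs outside it, and belongs to a graph with large
minimum degree and, up to rounding, at least the extremal number `(n² + 2n) / 4` of arcs. -/
structure NearExtremalCut {V : Type*} (r : V → V → Prop) (S T : Finset V) : Prop
    extends UniqueTwoPaths r where
  disjoint : Disjoint S T
  inDeg_le_outDeg : ∀ s ∈ S, inDeg r S s ≤ outDeg r T s
  outDeg_le_inDeg : ∀ t ∈ T, outDeg r T t ≤ inDeg r S t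
  le_degree : ∀ v, v ∈ S ∨ v ∈ T →
    #S + #T ≤ 2 * (outDeg r S v + outDeg r T v + inDeg r S v + inDeg r T v) + 1
  off_cut_le : arcs r S S + arcs r T T + arcs r T S ≤ 5 * (#S + #T)
  le_arcs : (#S + #T) ^ 2 + 2 * (#S + #T) ≤
    4 * (arcs r S T + arcs r S S + arcs r T T + arcs r T S)
  le_card : 10 ^ 7 ≤ #S + #T

namespace NearExtremalCut

variable {V : Type*} {r : V → V → Prop} {S T : Finset V}

lemma reverse (h : NearExtremalCut r S T) : NearExtremalCut (flip r) T S where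
  toUniqueTwoPaths := h.toUniqueTwoPaths.reverse
  disjoint := h.disjoint.symm
  inDeg_le_outDeg := h.outDeg_le_inDeg
  outDeg_le_inDeg := h.inDeg_le_outDeg
  le_degree v hv := by
    have := h.le_degree v hv.symm
    simp only [inDeg_flip, outDeg_flip]
    omega
  off_cut_le := by
    have := h.off_cut_le
    simp only [arcs_flip]
    omega
  le_arcs := by
    have := h.le_arcs
    simp only [arcs_flip]
    rw [add_comm #T]
    omega
  le_card := by
    have := h.le_card
    omega

lemma left_ne_right (h : NearExtremalCut r S T) {s t : V} (hs : s ∈ S) (ht : t ∈ T) : s ≠ t :=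
  fun e => disjoint_left.1 h.disjoint hs (e ▸ ht)

lemma card_add_two_mul_nonArcs_le (h : NearExtremalCut r S T) :
    #S + #T + 2 * nonArcs r S T ≤ 2 * (arcs r S S + arcs r T T) := by
  have hpairs := h.card_mul_card_eq S T
  have hamgm : 4 * (#S * #T) ≤ (#S + #T) ^ 2 := mul_assoc 4 #S #T ▸ four_mul_le_sq_add _ _
  have := h.le_arcs
  omega

lemma imbalance_le (h : NearExtremalCut r S T) :
    700 * max #S #T ≤ 700 * min #S #T + (#S + #T) := by
  have hpairs := h.card_mul_card_eq S T
  have hsq : (#S + #T) ^ 2 ≤ 4 * (#S * #T) + 20 * (#S + #T) := by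
    have := h.le_arcs
    have := h.off_cut_le
    omega
  have hlarge := h.le_card
  rw [← min_add_max #S #T, ← min_mul_max #S #T] at hsq
  rw [← min_add_max #S #T] at hlarge ⊢
  have hle : min #S #T ≤ max #S #T := min_le_max
  generalize max #S #T = a at *
  generalize min #S #T = b at *
  zify at *
  by_contra! hlt
  have : ((a : ℤ) - b) ^ 2 ≤ 20 * (b + a) := by linarith
  nlinarith

lemma inDeg_right_le (h : NearExtremalCut r S T) (w : V) : inDeg r T w ≤ 14 := by
  classical
  set R := {t ∈ T | r t w}
  have hin : ∑ t ∈ R, inDeg r (S ∪ T) t ≤ #S + #T := by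
    rw [← card_union_of_disjoint h.disjoint]
    exact h.sum_inDeg_le _ fun t ht => (mem_filter.1 ht).2
  have hout : ∑ t ∈ R, outDeg r S t ≤ arcs r T S := sum_le_sum_of_subset (filter_subset _ _)
  have hdeg : ∑ _t ∈ R, (#S + #T) ≤
      ∑ t ∈ R, (2 * outDeg r S t + 4 * inDeg r (S ∪ T) t + 1) := by
    refine sum_le_sum fun t ht => ?_
    have htT := (mem_filter.1 ht).1
    have := h.le_degree t (Or.inr htT)
    have := h.outDeg_le_inDeg t htT
    rw [inDeg_union h.disjoint]
    omega
  simp only [sum_add_distrib, ← mul_sum, sum_const, smul_eq_mul] at hdeg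
  change #R ≤ 14
  have hoff := h.off_cut_le
  have hlarge := h.le_card
  nlinarith

/-- If `s` and `t` have a common in-neighbour, their out-neighbourhoods in `T` are disjoint;
otherwise their in-neighbourhoods in `S` are. -/
lemma inDeg_add_outDeg_le (h : NearExtremalCut r S T) {s t : V} (hs : s ∈ S) (ht : t ∈ T) :
    inDeg r S s + outDeg r T t ≤ max #S #T := by
  by_cases hu : ∃ u, r u s ∧ r u t
  · obtain ⟨u, hus, hut⟩ := hu
    have := h.outDeg_add_outDeg_le (h.left_ne_right hs ht) hus hut T
    have := h.inDeg_le_outDeg s hs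
    omega
  · push Not at hu
    have := outDeg_add_outDeg_le_card (r := flip r) (A := S) fun u _ => hu u
    simp only [outDeg_flip] at this
    have := h.outDeg_le_inDeg t ht
    omega

lemma card_mul_arcs_left_le (h : NearExtremalCut r S T) :
    #T * arcs r S S ≤ ∑ s ∈ S, inDeg r S s * outDeg r T s + 14 * arcs r S S +
      ∑ s ∈ S, ∑ _t ∈ nonNbrs r T s, inDeg r S s := by
  simp only [sum_const, smul_eq_mul]
  rw [arcs_eq_sum_inDeg, mul_sum, mul_sum, ← sum_add_distrib, ← sum_add_distrib]
  refine sum_le_sum fun s _ => ?_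
  calc #T * inDeg r S s
      = inDeg r S s * outDeg r T s + inDeg r T s * inDeg r S s +
          #(nonNbrs r T s) * inDeg r S s := by rw [h.card_eq T s]; ring
    _ ≤ _ := by gcongr; exact h.inDeg_right_le s

/-- Count the paths of length two from `S` to `T`. -/
lemma card_mul_arcs_add_le (h : NearExtremalCut r S T) :
    #T * arcs r S S + #S * arcs r T T ≤ #S * #T + 14 * (arcs r S S + arcs r T T) +
      ∑ s ∈ S, ∑ t ∈ nonNbrs r T s, (inDeg r S s + outDeg r T t) := by
  classical
  have hpaths := h.sum_inDeg_mul_outDeg_le S T (S ∪ T)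
  rw [sum_union h.disjoint] at hpaths
  have hS := h.card_mul_arcs_left_le
  have hT := h.reverse.card_mul_arcs_left_le
  simp only [arcs_flip, inDeg_flip, outDeg_flip, nonNbrs_flip] at hT
  rw [sum_nonNbrs_comm r T S fun t _ => outDeg r T t] at hT
  simp only [mul_comm (outDeg r T _)] at hT
  simp only [sum_add_distrib]
  omega

/-- Each term is at most `max #S #T`, and `s₀` improves on this because
`inDeg r S s₀ ≤ outDeg r T s₀ = #T - (inDeg r T s₀ + #(nonNbrs r T s₀))`. -/
lemma sum_nonNbrs_le (h : NearExtremalCut r S T) {s₀ : V} (hs₀ : s₀ ∈ S) :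
    ∑ s ∈ S, ∑ t ∈ nonNbrs r T s, (inDeg r S s + outDeg r T t) +
        (inDeg r T s₀ + #(nonNbrs r T s₀)) * #(nonNbrs r T s₀) ≤
      max #S #T * nonArcs r S T + arcs r T T := by
  classical
  have hterm : ∀ s ∈ S.erase s₀, ∑ t ∈ nonNbrs r T s, (inDeg r S s + outDeg r T t) ≤
      max #S #T * #(nonNbrs r T s) := fun s hs => by
    rw [mul_comm]
    exact sum_le_card_nsmul _ _ _ fun t ht =>
      h.inDeg_add_outDeg_le (mem_of_mem_erase hs) (mem_nonNbrs.1 ht).1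
  have hs₀deg : inDeg r S s₀ + (inDeg r T s₀ + #(nonNbrs r T s₀)) ≤ max #S #T := by
    have := h.card_eq T s₀
    have := h.inDeg_le_outDeg s₀ hs₀
    omega
  have hs₀out : ∑ t ∈ nonNbrs r T s₀, outDeg r T t ≤ arcs r T T :=
    sum_le_sum_of_subset fun t ht => (mem_nonNbrs.1 ht).1
  have hs₀term := Nat.mul_le_mul_right #(nonNbrs r T s₀) hs₀deg
  have hrest := sum_le_sum hterm
  rw [← mul_sum] at hrest
  rw [nonArcs, ← add_sum_erase S _ hs₀, ← add_sum_erase S _ hs₀, sum_add_distrib, sum_const,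
    smul_eq_mul]
  linarith

lemma missing_mul_nonNbrs_le (h : NearExtremalCut r S T) {s : V} (hs : s ∈ S) :
    1400 * ((inDeg r T s + #(nonNbrs r T s)) * #(nonNbrs r T s)) ≤
      11 * (#S + #T) ^ 2 + 105000 * (#S + #T) := by
  have hpaths := h.card_mul_arcs_add_le
  have hloss := h.sum_nonNbrs_le hs
  have hmany := h.card_add_two_mul_nonArcs_le
  have hoff := h.off_cut_le
  have himb := h.imbalance_le
  set n := #S + #T
  set α := arcs r S S
  set β := arcs r T T
  set m := nonArcs r S T
  set p := (inDeg r T s + #(nonNbrs r T s)) * #(nonNbrs r T s)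
  set a := max #S #T
  set b := min #S #T
  have hsum : b + a = n := min_add_max _ _
  have hprod : b * a = #S * #T := min_mul_max _ _
  have hb : b * (α + β) ≤ #T * α + #S * β := by
    rw [mul_add]
    exact add_le_add (Nat.mul_le_mul_right _ (min_le_right _ _))
      (Nat.mul_le_mul_right _ (min_le_left _ _))
  have hp : b * (α + β) + p ≤ b * a + 15 * (α + β) + a * m := by omega
  have hbn : b * (n + 2 * m) ≤ b * (2 * (α + β)) := Nat.mul_le_mul_left b hmany
  have hba : b ≤ a := min_le_max
  zify at *
  have hd : 2 * (p : ℤ) ≤ (a - b) * (b + 2 * m) + 150 * n := by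
    rw [← hsum] at hbn ⊢
    linarith
  have hd' : ((a : ℤ) - b) * (b + 2 * m) ≤ (a - b) * (11 * n) :=
    mul_le_mul_of_nonneg_left (by linarith) (by linarith)
  nlinarith

/-- Otherwise `missing_mul_nonNbrs_le` fails, since `s` has at most `14` in-neighbours in `T`. -/
lemma missing_left_lt (h : NearExtremalCut r S T) {s : V} (hs : s ∈ S) :
    10 * (inDeg r T s + #(nonNbrs r T s)) < #S + #T := by
  have hle := h.missing_mul_nonNbrs_le hs
  have hin := h.inDeg_right_le s
  have hlarge := h.le_card
  set x := inDeg r T s + #(nonNbrs r T s)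
  by_contra! hx
  have hxy : x ≤ #(nonNbrs r T s) + 14 := by omega
  nlinarith

lemma missing_right_lt (h : NearExtremalCut r S T) {t : V} (ht : t ∈ T) :
    10 * (outDeg r S t + #(nonNbrs r S t)) < #S + #T := by
  have := h.reverse.missing_left_lt ht
  rwa [inDeg_flip, nonNbrs_flip, add_comm #T] at this

lemma outDeg_left_le_one (h : NearExtremalCut r S T) (w : V) : outDeg r S w ≤ 1 := by
  classical
  refine card_le_one.2 fun s hs s' hs' => ?_
  rw [mem_filter] at hs hs'
  by_contra hne
  have := h.outDeg_add_outDeg_le hne hs.2 hs'.2 T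
  have := h.missing_left_lt hs.1
  have := h.missing_left_lt hs'.1
  have := h.card_eq T s
  have := h.card_eq T s'
  have := h.imbalance_le
  omega

lemma inDeg_right_le_one (h : NearExtremalCut r S T) (w : V) : inDeg r T w ≤ 1 :=
  h.reverse.outDeg_left_le_one w

lemma arcs_left_le (h : NearExtremalCut r S T) : arcs r S S ≤ #S :=
  (sum_le_card_nsmul S (outDeg r S) 1 fun v _ => h.outDeg_left_le_one v).trans_eq (mul_one _)

lemma outDeg_left_pos_of_arcs_eq (h : NearExtremalCut r S T) (hS : arcs r S S = #S) {s : V}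
    (hs : s ∈ S) : ∃ s' ∈ S, r s s' := by
  rw [card_eq_sum_ones, arcs, sum_eq_sum_iff_of_le fun v _ => h.outDeg_left_le_one v] at hS
  exact outDeg_pos.1 (hS s hs ▸ one_pos)

lemma not_adj_or_not_adj (h : NearExtremalCut r S T) {u s t v : V} (hs : s ∈ S) (ht : t ∈ T)
    (hus : r u s) (htv : r t v) : ¬ r u t ∨ ¬ r s v := by
  by_contra! hadj
  exact h.left_ne_right hs ht (h.unique u s t v hus hadj.1 hadj.2 htv)

/-- If `u → s` in `S` and `u → t`, then `s` is not an in-neighbour of `v`, so `v → s`; as `v` has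
at most one out-neighbour in `S`, almost all arcs inside `S` point to the same vertex. -/
lemma exists_hub (h : NearExtremalCut r S T) {t v : V} (ht : t ∈ T) (htv : r t v)
    (hv : nonNbrs r S v = ∅) (hS : #S + #T ≤ 4 * arcs r S S) :
    ∃ x ∈ S, r v x ∧ #S + #T ≤ 10 * inDeg r S x := by
  classical
  have hsucc : ∀ u ∈ S, r u t → 0 < outDeg r S u → ∃ x ∈ S, r u x ∧ r v x := by
    intro u _ hut hu
    obtain ⟨x, hx, hux⟩ := outDeg_pos.1 hu
    refine ⟨x, hx, hux, ?_⟩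
    exact (adj_or_adj_of_nonNbrs_eq_empty hv hx).resolve_right
      ((h.not_adj_or_not_adj hx ht hux htv).resolve_left (not_not.2 hut))
  have hmiss : 10 * #{u ∈ S | ¬ r u t} < #S + #T := by
    have hsub : {u ∈ S | ¬ r u t} ⊆ {u ∈ S | r t u} ∪ nonNbrs r S t := fun u hu => by
      simp only [mem_union, mem_filter, mem_nonNbrs] at hu ⊢
      tauto
    have := (card_le_card hsub).trans (card_union_le _ _)
    have := h.missing_right_lt ht
    rw [outDeg] at this
    omega
  have hcount : arcs r S S ≤ #{u ∈ S | ∃ x ∈ S, r u x ∧ r v x} + #{u ∈ S | ¬ r u t} := by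
    rw [card_filter, card_filter, ← sum_add_distrib]
    refine sum_le_sum fun u hu => ?_
    have := h.outDeg_left_le_one u
    have := hsucc u hu
    split_ifs <;> grind
  obtain ⟨u, hu⟩ : {u ∈ S | ∃ x ∈ S, r u x ∧ r v x}.Nonempty := card_pos.1 (by omega)
  obtain ⟨x, hx, -, hvx⟩ := (mem_filter.1 hu).2
  refine ⟨x, hx, hvx, ?_⟩
  have hstar : #{u ∈ S | ∃ x ∈ S, r u x ∧ r v x} ≤ inDeg r S x := by
    refine card_le_card (monotone_filter_right S fun u _ => ?_)
    rintro ⟨y, hy, huy, hvy⟩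
    exact eq_of_outDeg_le_one (h.outDeg_left_le_one v) hy hx hvy hvx ▸ huy
  omega

lemma not_adj_of_hub (h : NearExtremalCut r S T) {x t v : V} (hx : x ∈ S)
    (hub : #S + #T ≤ 10 * inDeg r S x) (ht : t ∈ T) (htv : r t v) : ¬ r x v := by
  have hcard := h.card_eq S t
  have hmiss := h.missing_right_lt ht
  obtain ⟨u, -, hux, hut⟩ := exists_common_inNbr (r := r) (A := S) (y := x) (y' := t) (by omega)
  exact (h.not_adj_or_not_adj hx ht hux htv).resolve_left (not_not.2 hut)

lemma inDeg_right_eq_zero_of_hub (h : NearExtremalCut r S T) {x : V} (hx : x ∈ S)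
    (hub : #S + #T ≤ 10 * inDeg r S x) {w : V} (hw : r x w) : inDeg r T w = 0 := by
  by_contra hpos
  obtain ⟨t, ht, htw⟩ := inDeg_pos.1 (Nat.pos_of_ne_zero hpos)
  exact h.not_adj_of_hub hx hub ht htw hw

lemma inDeg_right_add_ite_le_of_hub (h : NearExtremalCut r S T) {x : V} (hx : x ∈ S)
    (hub : #S + #T ≤ 10 * inDeg r S x) (w : V) [Decidable (r x w)] :
    inDeg r T w + (if r x w then 1 else 0) ≤ 1 := by
  split_ifs with hw
  · rw [h.inDeg_right_eq_zero_of_hub hx hub hw]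
  · exact h.inDeg_right_le_one w

lemma arcs_right_add_outDeg_le_of_hub (h : NearExtremalCut r S T) {x : V} (hx : x ∈ S)
    (hub : #S + #T ≤ 10 * inDeg r S x) : arcs r T T + outDeg r T x ≤ #T := by
  classical
  rw [arcs_eq_sum_inDeg, outDeg, card_filter, ← sum_add_distrib, card_eq_sum_ones]
  exact sum_le_sum fun w _ => h.inDeg_right_add_ite_le_of_hub hx hub w

lemma arcs_right_add_outDeg_lt_of_hub (h : NearExtremalCut r S T) {x w : V} (hx : x ∈ S)
    (hub : #S + #T ≤ 10 * inDeg r S x) (hw : w ∈ T) (hxw : ¬ r x w) (hw0 : inDeg r T w = 0) :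
    arcs r T T + outDeg r T x < #T := by
  classical
  rw [arcs_eq_sum_inDeg, outDeg, card_filter, ← sum_add_distrib, card_eq_sum_ones]
  refine sum_lt_sum (fun w _ => h.inDeg_right_add_ite_le_of_hub hx hub w) ⟨w, hw, ?_⟩
  rw [hw0, if_neg hxw]
  exact zero_lt_one

lemma not_adj_and_inDeg_eq_zero (h : NearExtremalCut r S T) {x y z t v : V} (hx : x ∈ S)
    (hy : y ∈ S) (hz : z ∈ S) (ht : t ∈ T) (hxy : r x y) (hyz : r y z) (htv : r t v)
    (hvx : r v x) (hSv : nonNbrs r S v = ∅) (hTy : nonNbrs r T y = ∅)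
    (hTz : nonNbrs r T z = ∅) : ¬ r x t ∧ inDeg r T t = 0 := by
  have hto_v : ∀ s ∈ S, s ≠ x → r s v := fun s hs hne =>
    (adj_or_adj_of_nonNbrs_eq_empty hSv hs).resolve_left fun hvs =>
      hne (eq_of_outDeg_le_one (h.outDeg_left_le_one v) hs hx hvs hvx)
  have hyv : r y v := hto_v y hy fun e => h.irrefl x (e ▸ hxy)
  have hzv : r z v := hto_v z hz fun e => h.asymm x y hxy (e ▸ hyz)
  have hty : r t y := (adj_or_adj_of_nonNbrs_eq_empty hTy ht).resolve_left
    ((h.not_adj_or_not_adj hz ht hyz htv).resolve_right (not_not.2 hzv))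
  refine ⟨(h.not_adj_or_not_adj hy ht hxy htv).resolve_right (not_not.2 hyv), ?_⟩
  by_contra hpos
  obtain ⟨t', ht', htt⟩ := inDeg_pos.1 (Nat.pos_of_ne_zero hpos)
  rcases h.not_adj_or_not_adj hz ht' hyz htt with hyt' | hzt
  · have ht'y : r t' y := (adj_or_adj_of_nonNbrs_eq_empty hTy ht').resolve_left hyt'
    have htt' : t' = t := eq_of_inDeg_le_one (h.inDeg_right_le_one y) ht' ht ht'y hty
    exact h.irrefl t (htt' ▸ htt)
  · have htz : r t z := (adj_or_adj_of_nonNbrs_eq_empty hTz ht).resolve_left hzt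
    have hzy : z = y := eq_of_outDeg_le_one (h.outDeg_left_le_one t) hz hy htz hty
    exact h.irrefl y (hzy ▸ hyz)

lemma exists_inDeg_pos_nonNbrs_eq_empty (h : NearExtremalCut r S T)
    (hlt : nonArcs r S T < arcs r T T) :
    ∃ v ∈ T, 0 < inDeg r T v ∧ nonNbrs r S v = ∅ := by
  rw [nonArcs_comm, nonArcs, arcs_eq_sum_inDeg] at hlt
  obtain ⟨v, hv, hlt⟩ := exists_lt_of_sum_lt hlt
  have := h.inDeg_right_le_one v
  exact ⟨v, hv, by omega, card_eq_zero.1 (by omega)⟩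

/-- If the bound fails, some vertex of `T` with an in-neighbour in `T` is joined to all of `S` and
there is a hub `x`. Counting the pairs missing at `x` then makes everything tight: each vertex of
`S` has an out-neighbour in `S` and only `x` has non-neighbours in `T`. -/
lemma arcs_left_add_arcs_right_le_of_le (h : NearExtremalCut r S T)
    (hle : arcs r T T ≤ arcs r S S) :
    arcs r S S + arcs r T T ≤ max #S #T + nonArcs r S T := by
  classical
  by_contra! hlt
  have hSle := h.arcs_left_le
  obtain ⟨v, -, hvpos, hSv⟩ := h.exists_inDeg_pos_nonNbrs_eq_empty (by omega)
  obtain ⟨t, ht, htv⟩ := inDeg_pos.1 hvpos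
  obtain ⟨x, hx, hvx, hub⟩ := h.exists_hub ht htv hSv (by
    have := h.card_add_two_mul_nonArcs_le
    omega)
  have hTx := h.card_eq T x
  have hinx := h.inDeg_right_le_one x
  have hcount := h.arcs_right_add_outDeg_le_of_hub hx hub
  have hsplit : #(nonNbrs r T x) + ∑ s ∈ S.erase x, #(nonNbrs r T s) = nonArcs r S T :=
    add_sum_erase S (fun s => #(nonNbrs r T s)) hx
  have hrest : ∀ s ∈ S, s ≠ x → nonNbrs r T s = ∅ := fun s hs hne => by
    have hzero : ∑ s ∈ S.erase x, #(nonNbrs r T s) = 0 := by omega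
    exact card_eq_zero.1 (sum_eq_zero_iff.1 hzero s (mem_erase.2 ⟨hne, hs⟩))
  have hfull : arcs r S S = #S := by omega
  obtain ⟨y, hy, hxy⟩ := h.outDeg_left_pos_of_arcs_eq hfull hx
  obtain ⟨z, hz, hyz⟩ := h.outDeg_left_pos_of_arcs_eq hfull hy
  obtain ⟨hxt, ht0⟩ := h.not_adj_and_inDeg_eq_zero hx hy hz ht hxy hyz htv hvx hSv
    (hrest y hy fun e => h.irrefl x (e ▸ hxy)) (hrest z hz fun e => h.asymm x y hxy (e ▸ hyz))
  have hstrict := h.arcs_right_add_outDeg_lt_of_hub hx hub ht hxt ht0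
  omega

lemma arcs_left_add_arcs_right_le (h : NearExtremalCut r S T) :
    arcs r S S + arcs r T T ≤ max #S #T + nonArcs r S T := by
  rcases le_total (arcs r T T) (arcs r S S) with hle | hle
  · exact h.arcs_left_add_arcs_right_le_of_le hle
  · have := h.reverse.arcs_left_add_arcs_right_le_of_le (by rwa [arcs_flip, arcs_flip])
    simp only [nonArcs, nonNbrs_flip, arcs_flip] at this
    rw [← nonArcs, nonArcs_comm, max_comm] at this
    omega

lemma four_mul_arcs_le (h : NearExtremalCut r S T) :
    4 * (arcs r S T + arcs r S S + arcs r T T + arcs r T S) ≤ (#S + #T + 1) ^ 2 := by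
  have hpairs := h.card_mul_card_eq S T
  have hinner := h.arcs_left_add_arcs_right_le
  rcases le_total #S #T with hle | hle
  · rw [max_eq_right hle] at hinner
    nlinarith [four_mul_le_sq_add (#S + 1) #T]
  · rw [max_eq_left hle] at hinner
    nlinarith [four_mul_le_sq_add #S (#T + 1)]

end NearExtremalCut

namespace UniqueTwoPaths

variable {V : Type*} {r : V → V → Prop}

lemma four_mul_arcs_le_of_le_degree (h : UniqueTwoPaths r) {W : Finset V} (hW : 10 ^ 7 ≤ #W)
    (hdeg : ∀ v ∈ W, #W ≤ 2 * (outDeg r W v + inDeg r W v) + 1) :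
    4 * arcs r W W ≤ (#W + 1) ^ 2 := by
  classical
  by_contra! hlt
  obtain ⟨S, T, hcut, rfl⟩ := exists_isMaxCut r W
  have hoff := hcut.arcs_self_le
  have hmin := h.sum_min_degree_le (by omega) hdeg
  rw [card_union_of_disjoint hcut.disjoint] at *
  have hsplit := arcs_union_self (r := r) hcut.disjoint
  have hextremal : NearExtremalCut r S T :=
    { toUniqueTwoPaths := h
      disjoint := hcut.disjoint
      inDeg_le_outDeg := fun s hs => hcut.inDeg_le_outDeg hs (h.irrefl s)
      outDeg_le_inDeg := fun t ht => hcut.outDeg_le_inDeg ht (h.irrefl t)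
      le_degree := fun v hv => by
        have := hdeg v (mem_union.2 hv)
        rw [outDeg_union hcut.disjoint, inDeg_union hcut.disjoint] at this
        omega
      off_cut_le := by omega
      le_arcs := by linarith
      le_card := hW }
  have := hextremal.four_mul_arcs_le
  omega

/-- Apply the bound for large minimum degree to a set `W` maximizing
`4 * arcs r W W - (#W + 1) ^ 2 + 4 * #W`: deleting a vertex of degree less than `(#W - 1) / 2` would
increase this quantity, and its value on `univ` prevents `W` from being small. -/
lemma four_mul_arcs_univ_le [Fintype V] (h : UniqueTwoPaths r)
    (hV : 10 ^ 15 ≤ Fintype.card V) :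
    4 * arcs r univ univ ≤ (Fintype.card V + 1) ^ 2 := by
  classical
  by_contra! hlt
  obtain ⟨W, -, hmax⟩ := exists_max_image (univ : Finset (Finset V))
    (fun W => 4 * (arcs r W W : ℤ) - (#W + 1) ^ 2 + 4 * #W) univ_nonempty
  have huniv := hmax univ (mem_univ _)
  rw [card_univ] at huniv
  have hWV : #W ≤ Fintype.card V := card_le_univ W
  have hWW := arcs_le_card_mul_card (r := r) W W
  zify at hlt hWV hWW hV
  have hlarge : 10 ^ 7 ≤ #W := by
    by_contra! hsmall
    zify at hsmall
    nlinarith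
  have hle := h.four_mul_arcs_le_of_le_degree hlarge fun v hv => by
    have hdel := hmax (W.erase v) (mem_univ _)
    have harcs := arcs_erase_erase (h.irrefl v) hv
    have hcard := card_erase_add_one hv
    zify at harcs hcard ⊢
    rw [← harcs, ← hcard] at hdel
    rw [← hcard]
    linarith
  zify at hle
  linarith

end UniqueTwoPaths

section Digraph

variable {V : Type*}

lemma uniqueTwoPaths_adj_iff {G : Digraph V} :
    UniqueTwoPaths G.Adj ↔ IsOriented G ∧ Free G orientedC4 := by
  constructor
  · refine fun h => ⟨h.asymm, fun ⟨φ, hφ, hG⟩ => ?_⟩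
    have h12 : φ 1 = φ 2 := h.unique (φ 0) (φ 1) (φ 2) (φ 3) (hG 0 1 (by simp [orientedC4]))
      (hG 0 2 (by simp [orientedC4])) (hG 1 3 (by simp [orientedC4]))
      (hG 2 3 (by simp [orientedC4]))
    exact absurd (hφ h12) (by decide)
  · rintro ⟨hor, hfree⟩
    refine ⟨hor, fun x y y' z hxy hxy' hyz hy'z => by_contra fun hyy' => hfree ?_⟩
    have ne_of_adj : ∀ {u v}, G.Adj u v → u ≠ v := by
      rintro u v huv rfl
      exact hor u u huv huv
    have hxz : x ≠ z := fun e => hor x y hxy (e ▸ hyz)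
    refine ⟨![x, y, y', z], fun i j hij => ?_, ?_⟩
    · fin_cases i <;> fin_cases j <;>
        simp_all [ne_of_adj hxy, ne_of_adj hxy', ne_of_adj hyz, ne_of_adj hy'z, eq_comm]
    · rintro a b (⟨rfl, rfl⟩ | ⟨rfl, rfl⟩ | ⟨rfl, rfl⟩ | ⟨rfl, rfl⟩) <;> assumption

lemma arcCount_eq_arcs [Fintype V] (G : Digraph V) : arcCount G = arcs G.Adj univ univ := by
  classical
  rw [arcCount, ← coe_filter_univ, Set.ncard_coe_finset, card_filter, Fintype.sum_prod_type]
  simp only [arcs, outDeg, card_filter]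

/-- The arcs of the construction: those from `A` to its complement, and `u → f u` for `u ∈ A`. -/
def BipartiteWithMap (A : Finset V) (f : V → V) (u v : V) : Prop :=
  (u ∈ A ∧ v ∉ A) ∨ (u ∈ A ∧ v = f u)

lemma uniqueTwoPaths_bipartiteWithMap {A : Finset V} {f : V → V}
    (hf : ∀ u ∈ A, f (f u) ≠ u) : UniqueTwoPaths (BipartiteWithMap A f) where
  asymm := by
    rintro u v (⟨-, hv⟩ | ⟨hu, rfl⟩) (⟨hv', hu'⟩ | ⟨hv', hu'⟩)
    · exact hv hv'
    · exact hv hv'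
    · exact hu' hu
    · exact hf u hu hu'.symm
  unique := by
    have middle_eq : ∀ x y z, BipartiteWithMap A f x y → BipartiteWithMap A f y z → y = f x := by
      rintro x y z (⟨-, hy⟩ | ⟨-, hy⟩) hyz
      · exact absurd (hyz.elim And.left And.left) hy
      · exact hy
    intro x y y' z hxy hxy' hyz hy'z
    rw [middle_eq x y z hxy hyz, middle_eq x y' z hxy' hy'z]

lemma arcs_bipartiteWithMap [Fintype V] {A : Finset V} {f : V → V} (hA : ∀ u ∈ A, f u ∈ A) :
    arcs (BipartiteWithMap A f) univ univ = #A * (Fintype.card V - #A + 1) := by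
  classical
  have hout : ∀ u, outDeg (BipartiteWithMap A f) univ u =
      if u ∈ A then Fintype.card V - #A + 1 else 0 := by
    intro u
    split_ifs with hu
    · rw [← card_compl, ← card_insert_of_notMem (a := f u) (by simpa using hA u hu), outDeg]
      congr 1
      ext w
      simp only [BipartiteWithMap, mem_filter, mem_univ, true_and, hu, mem_insert, mem_compl]
      exact or_comm
    · simp [outDeg, BipartiteWithMap, hu]
  simp only [arcs, hout, sum_ite_mem, univ_inter, sum_const, smul_eq_mul]

end Digraph

lemma apply_apply_ne_of_isCycle {α : Type*} [Fintype α] [DecidableEq α] {σ : Equiv.Perm α}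
    (hσ : σ.IsCycle) (hcard : 3 ≤ #σ.support) {u : α} (hu : u ∈ σ.support) : σ (σ u) ≠ u := by
  intro hfix
  have hsq : σ ^ 2 = 1 := hσ.pow_eq_one_iff.2 ⟨u, Equiv.Perm.mem_support.1 hu, hfix⟩
  have := Nat.le_of_dvd two_pos (hσ.orderOf ▸ orderOf_dvd_of_pow_eq_one hsq)
  omega

lemma sq_div_four_add_half (n : ℕ) : n ^ 2 / 4 + (n + 1) / 2 = (n + 1) ^ 2 / 4 := by
  obtain ⟨k, rfl | rfl⟩ := n.even_or_odd' <;> ring_nf <;> omega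

lemma half_mul_half_add_one (n : ℕ) :
    (n + 1) / 2 * (n - (n + 1) / 2 + 1) = (n + 1) ^ 2 / 4 := by
  obtain ⟨k, rfl | rfl⟩ := n.even_or_odd'
  · rw [show (2 * k + 1) / 2 = k by omega, show 2 * k - k + 1 = k + 1 by omega]
    ring_nf
    omega
  · rw [show (2 * k + 1 + 1) / 2 = k + 1 by omega, show 2 * k + 1 - (k + 1) + 1 = k + 1 by omega]
    ring_nf
    omega

namespace IsBipartiteWithCycle

variable {n : ℕ} {G : Digraph (Fin n)}

lemma exists_adj_eq (h : IsBipartiteWithCycle G) :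
    ∃ (A : Finset (Fin n)) (σ : Equiv.Perm (Fin n)),
      #A = (n + 1) / 2 ∧ σ.IsCycle ∧ σ.support = A ∧
      (G.Adj = BipartiteWithMap A σ ∨ G.Adj = flip (BipartiteWithMap A σ)) := by
  obtain ⟨A, σ, hcard, hσ, rfl, hG | hG⟩ := h
  · exact ⟨_, σ, hcard, hσ, rfl, .inl (by ext u v; exact hG u v)⟩
  · refine ⟨_, σ⁻¹, hcard, hσ.inv, σ.support_inv, .inr ?_⟩
    ext u v
    have hcycle : u ∈ σ.support ∧ v = σ u ↔ v ∈ σ.support ∧ u = σ⁻¹ v := by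
      rw [Equiv.Perm.eq_inv_iff_eq, eq_comm]
      exact and_congr_left fun e => e ▸ Equiv.Perm.apply_mem_support.symm
    rw [hG, hcycle, flip, BipartiteWithMap, and_comm (a := u ∉ σ.support)]

lemma uniqueTwoPaths_and_arcs_eq (h : IsBipartiteWithCycle G) (hn : 5 ≤ n) :
    UniqueTwoPaths G.Adj ∧ arcs G.Adj univ univ = (n + 1) ^ 2 / 4 := by
  obtain ⟨A, σ, hcard, hσ, rfl, hG⟩ := h.exists_adj_eq
  have hmem : ∀ u ∈ σ.support, σ u ∈ σ.support := fun u => Equiv.Perm.apply_mem_support.2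
  have hunique := uniqueTwoPaths_bipartiteWithMap fun u =>
    apply_apply_ne_of_isCycle hσ (by omega)
  have harcs := arcs_bipartiteWithMap hmem
  rw [hcard, Fintype.card_fin, half_mul_half_add_one] at harcs
  rcases hG with hG | hG <;> rw [hG]
  · exact ⟨hunique, harcs⟩
  · exact ⟨hunique.reverse, by rw [arcs_flip, harcs]⟩

lemma spec (h : IsBipartiteWithCycle G) (hn : 5 ≤ n) :
    IsOriented G ∧ Free G orientedC4 ∧ arcCount G = n ^ 2 / 4 + (n + 1) / 2 := by
  obtain ⟨hunique, harcs⟩ := h.uniqueTwoPaths_and_arcs_eq hn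
  obtain ⟨hor, hfree⟩ := uniqueTwoPaths_adj_iff.1 hunique
  exact ⟨hor, hfree, by rw [arcCount_eq_arcs, harcs, sq_div_four_add_half]⟩

end IsBipartiteWithCycle

lemma exists_isBipartiteWithCycle {n : ℕ} (hn : 3 ≤ n) :
    ∃ G : Digraph (Fin n), IsBipartiteWithCycle G := by
  obtain ⟨A, -, hA⟩ := exists_subset_card_eq (s := (univ : Finset (Fin n)))
    (n := (n + 1) / 2) (by rw [card_univ, Fintype.card_fin]; omega)
  have hlen : 2 ≤ A.toList.length := by rw [length_toList]; omega
  have hsupp : A.toList.formPerm.support = A := by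
    rw [List.support_formPerm_of_nodup _ A.nodup_toList, toList_toFinset]
    intro x hx
    rw [hx, List.length_singleton] at hlen
    omega
  exact ⟨⟨BipartiteWithMap A A.toList.formPerm⟩, A, A.toList.formPerm, hA,
    List.isCycle_formPerm A.nodup_toList hlen, hsupp, .inl fun _ _ => Iff.rfl⟩

lemma arcCount_le {n : ℕ} (hn : 10 ^ 15 ≤ n) {G : Digraph (Fin n)} (hG : IsOriented G)
    (hfree : Free G orientedC4) : arcCount G ≤ n ^ 2 / 4 + (n + 1) / 2 := by
  have h := (uniqueTwoPaths_adj_iff.2 ⟨hG, hfree⟩).four_mul_arcs_univ_le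
    (by rwa [Fintype.card_fin])
  rw [Fintype.card_fin, ← arcCount_eq_arcs] at h
  rw [sq_div_four_add_half]
  omega

end OrientedTuran

/-- For all sufficiently large `n`, the oriented Turán number of the `C₄` with arcs
`x → y₁ → z`, `x → y₂ → z` is `⌊n²/4⌋ + ⌈n/2⌉` (division below is that of natural numbers), and it
is attained by the antidirected balanced complete bipartite graph with a directed cycle added
inside the larger part. -/
theorem theorem3p2 :
    ∃ N : ℕ, ∀ n : ℕ, N ≤ n →
      OrientedTuran.exo n OrientedTuran.orientedC4 = n ^ 2 / 4 + (n + 1) / 2 ∧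
      (∃ G : Digraph (Fin n), OrientedTuran.IsBipartiteWithCycle G) ∧
      (∀ G : Digraph (Fin n), OrientedTuran.IsBipartiteWithCycle G →
        OrientedTuran.IsOriented G ∧
        OrientedTuran.Free G OrientedTuran.orientedC4 ∧
        OrientedTuran.arcCount G = n ^ 2 / 4 + (n + 1) / 2) := by
  classical
  refine ⟨10 ^ 15, fun n hn => ?_⟩
  obtain ⟨G, hG⟩ := OrientedTuran.exists_isBipartiteWithCycle (n := n) (by omega)
  refine ⟨le_antisymm ?upper ?lower, ⟨G, hG⟩, fun G hG => hG.spec (by omega)⟩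
  case upper =>
    refine Finset.sup_le fun G hG => ?_
    obtain ⟨-, hor, hfree⟩ := Finset.mem_filter.1 hG
    exact OrientedTuran.arcCount_le hn hor hfree
  case lower =>
    obtain ⟨hor, hfree, hcount⟩ := hG.spec (by omega)
    rw [← hcount]
    exact Finset.le_sup (f := OrientedTuran.arcCount)
      (Finset.mem_filter.2 ⟨Finset.mem_univ _, hor, hfree⟩)
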